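/- A \emph{limit sketch} is a small category $E$ together with a small family $(C_\alpha)_{\alpha\in A}$ of cones $C_\alpha=(x_\alpha, I_\alpha, \phi_\alpha\colon I_\alpha\to E, \delta_\alpha\colon *_{x_\alpha}\Rightarrow\phi_\alpha)$ in $E$, with $I_\alpha$ small, such that for every object $e$ of $E$ the cone $(e,\mathbf 1,*_e,\mathrm{id})$ is one of the $C_\alpha$. A map $(E,(C_\alpha)_{\alpha\in A})\to(E',(C'_\beta)_{\beta\in B})$ consists of a functor $F\colon E\to E'$ and a function $f\colon A\to B$ such that $F x_\alpha=x'_{f(\alpha)}$, $I_\alpha=I'_{f(\alpha)}$, $F\phi_\alpha=\phi'_{f(\alpha)}$ and $F\delta_\alpha=\delta'_{f(\alpha)}$ for all $\alpha$. Let $\mathrm{LimSk}$ be the category of limit sketches, $\mathrm{ReLimSk}$ its full subcategory of \emph{realized} limit sketches, those in which all specified cones are limit cones, and $U\colon\mathrm{ReLimSk}\to\mathrm{LimSk}$ the inclusion. Let $(E,(C_\alpha)_{\alpha\in A})$ be a limit sketch. For $y\in\mathrm{ob}\,E$ and $\alpha\in A$ let $E[y;\alpha]$ be the category obtained from $E$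 by freely adjoining morphisms $\gamma_i\colon y\to\phi_\alpha(i)$, $i\in\mathrm{ob}\,I_\alpha$, subject to $\phi_\alpha(g)\circ\gamma_i=\gamma_j$ for all $g\colon i\to j$ in $I_\alpha$, and let $r_{y,\alpha}\colon E[y;\alpha]\to E[y;\alpha]'$ be obtained by further freely adjoining a morphism $\bar\gamma\colon y\to x_\alpha$ subject to $(\delta_\alpha)_i\circ\bar\gamma=\gamma_i$ for all $i$. Let $\Xi$ be the set of all $r_{y,\alpha}$, regarded as morphisms of the coslice $E/\mathrm{Cat}$ of the category of small categories. Let $\mathcal R$ be the class of the morphisms of $E/\mathrm{Cat}$ that have the unique right lifting property with respect to $\Xi$, and $\mathcal L$ the class of those that have the unique left lifting property with respect to $\mathcal R$. Let $$E\xrightarrow{\ \lambda_!(E)\ }\mathrm{fibr}(E)\longrightarrow *$$ be a factorization in $E/\mathrm{Cat}$ of the map from $\mathrm{id}_E$ to the terminal object, with first map in $\mathcal L$ and second map in $\mathcal R$. \textbf{Lemma.} Such a factorization exists for every limit sketch. Moreover, for every choice of such a factorization for each limit sketch, the following holds. Setting $$\mathrm{Fr}(E,(C_\alpha)_{\alpha\in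 A}):=(\mathrm{fibr}(E),(\lambda_!(E)(C_\alpha))_{\alpha\in A})$$ gives a well-defined realized limit sketch for every limit sketch. This assignment on objects extends to a functor $\mathrm{Fr}\colon\mathrm{LimSk}\to\mathrm{ReLimSk}$ for which the maps $\lambda_!(E)\colon E\to\mathrm{fibr}(E)$, taken together with the identity functions of the index sets $A$, are the components of a natural transformation $\lambda_!\colon 1_{\mathrm{LimSk}}\Rightarrow U\circ\mathrm{Fr}$. -/

import Mathlib

open CategoryTheory CategoryTheory.Limits

universe u

namespace LimitSketch

/-! ### Limit sketches -/

/-- A cone `(x, I, φ, δ)` in a category `E`, with a small indexing category `I`. -/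
structure SketchCone (E : Type u) [Category.{u} E] where
  /-- the indexing category `I` -/
  shape : Cat.{u, u}
  /-- the diagram `φ : I ⥤ E` -/
  diagram : shape ⥤ E
  /-- the vertex `x` (its field `pt`) and the natural transformation `δ` (its field `π`) -/
  cone : Cone diagram

namespace SketchCone

variable {E : Type u} [Category.{u} E] {D : Type u} [Category.{u} D]

/-- The vertex `x` of a cone. -/
abbrev vertex (C : SketchCone E) : E := C.cone.pt

/-- The component `δ_i : x ⟶ φ i` of a cone. -/
abbrev leg (C : SketchCone E) (i : C.shape) : C.vertex ⟶ C.diagram.obj i := C.cone.π.app i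

/-- The image `(F x, I, F φ, F δ)` of a cone under a functor `F`. -/
def map (C : SketchCone E) (F : E ⥤ D) : SketchCone D where
  shape := C.shape
  diagram := C.diagram ⋙ F
  cone := F.mapCone C.cone

/-- The cone `(e, 𝟏, *_e, id)` over the terminal category. -/
def idCone (e : E) : SketchCone E where
  shape := Cat.of (Discrete PUnit.{u + 1})
  diagram := (Functor.const _).obj e
  cone := { pt := e, π := 𝟙 _ }

end SketchCone

/-- A limit sketch: a small category together with a (small) family of cones in it, which
contains the cone `(e, 𝟏, *_e, id)` for every object `e`. -/
structure LimSk where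
  /-- the underlying category -/
  cat : Cat.{u, u}
  /-- the index set of the specified cones -/
  index : Type u
  /-- the specified cones -/
  cone : index → SketchCone cat
  /-- the cones `(e, 𝟏, *_e, id)` are among the specified ones -/
  exists_idCone : ∀ e : cat, ∃ α, cone α = SketchCone.idCone e

namespace LimSk

/-- A map of limit sketches: a functor `F` and a function `f` between the index sets such that
the image under `F` of the cone with index `α` is (strictly) the cone with index `f α`. -/
@[ext]
structure Hom (S T : LimSk.{u}) where
  /-- the functor between the underlying categories -/
  functor : S.cat ⥤ T.cat
  /-- the function between the index sets -/
  onIndex : S.index → T.index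
  map_cone : ∀ α, (S.cone α).map functor = T.cone (onIndex α)

/-- The category of limit sketches. -/
instance : Category LimSk.{u} where
  Hom := Hom
  id S := { functor := 𝟭 _, onIndex := id, map_cone := fun _ => rfl }
  comp F G :=
    { functor := F.functor ⋙ G.functor
      onIndex := G.onIndex ∘ F.onIndex
      map_cone := fun α =>
        (congrArg (fun C => SketchCone.map C G.functor) (F.map_cone α)).trans
          (G.map_cone (F.onIndex α)) }

/-- A limit sketch is realized if all its specified cones are limit cones. -/
def IsRealized : ObjectProperty LimSk.{u} := fun S =>
  ∀ α : S.index, Nonempty (IsLimit (S.cone α).cone)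

end LimSk

/-- The category of realized limit sketches, a full subcategory of the one of limit sketches.
Its inclusion `U` into `LimSk` is `LimSk.IsRealized.ι`. -/
abbrev ReLimSk : Type (u + 1) := LimSk.IsRealized.{u}.FullSubcategory

/-! ### Freely adjoining morphisms to a category -/

section Adjoin

variable {E : Type u} [Category.{u} E] {K : Type u} (s t : K → E)

/-- The graph on the objects of `E` whose edges are the morphisms of `E` and, for every `k : K`,
an additional edge from `s k` to `t k`. -/
inductive AdjoinEdge : E → E → Type u
  | of {a b : E} (f : a ⟶ b) : AdjoinEdge a b
  | new (k : K) : AdjoinEdge (s k) (t k)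

/-- The vertices of the graph `AdjoinEdge s t`. -/
@[nolint unusedArguments]
def AdjoinGraph (_s _t : K → E) : Type u := E

instance : Quiver.{u} (AdjoinGraph s t) where
  Hom a b := AdjoinEdge s t a b

/-- An edge of the graph as a morphism of the free category on the graph. -/
def AdjoinEdge.path {s t : K → E} {a b : E} (e : AdjoinEdge s t a b) :
    (Paths.of (AdjoinGraph s t)).obj a ⟶ (Paths.of (AdjoinGraph s t)).obj b :=
  (Paths.of (AdjoinGraph s t)).map e

/-- The relations which say that the composition and the identities of `E` are respected. -/
inductive AdjoinRel : HomRel (Paths (AdjoinGraph s t))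
  | id (a : E) :
      AdjoinRel (AdjoinEdge.of (𝟙 a) : AdjoinEdge s t a a).path
        (𝟙 ((Paths.of (AdjoinGraph s t)).obj a))
  | comp {a b c : E} (f : a ⟶ b) (g : b ⟶ c) :
      AdjoinRel (AdjoinEdge.of (f ≫ g) : AdjoinEdge s t a c).path
        ((AdjoinEdge.of f : AdjoinEdge s t a b).path ≫
          (AdjoinEdge.of g : AdjoinEdge s t b c).path)

/-- The category obtained from `E` by freely adjoining a morphism `s k ⟶ t k` for every `k : K`.
It is the pushout of the counit `free (U E) ⥤ E` along the functor from `free (U E)` to the free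
category on the graph above, presented by generators and relations. -/
abbrev Adjoin : Type u := CategoryTheory.Quotient (AdjoinRel s t)

namespace Adjoin

/-- The object of `Adjoin s t` given by an object of `E`. -/
def ob (a : E) : Adjoin s t := ⟨(Paths.of (AdjoinGraph s t)).obj a⟩

/-- The class in `Adjoin s t` of an edge of the graph. -/
def edge {a b : E} (e : AdjoinEdge s t a b) : ob s t a ⟶ ob s t b :=
  (CategoryTheory.Quotient.functor (AdjoinRel s t)).map e.path

/-- The canonical functor `E ⥤ Adjoin s t`. -/
def incl : E ⥤ Adjoin s t where
  obj a := ob s t a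
  map f := edge s t (.of f)
  map_id a := CategoryTheory.Quotient.sound _ (AdjoinRel.id a)
  map_comp f g := (CategoryTheory.Quotient.sound _ (AdjoinRel.comp f g)).trans (Functor.map_comp _ _ _)

/-- The adjoined morphism `s k ⟶ t k`. -/
def new (k : K) : (incl s t).obj (s k) ⟶ (incl s t).obj (t k) := edge s t (.new k)

end Adjoin

end Adjoin

/-! ### The generating morphisms -/

section Generators

variable {E : Type u} [Category.{u} E] (C : SketchCone E) (y : E)

/-- `E` with a family of morphisms `γ_i : y ⟶ φ i` freely adjoined, where `i` runs over the
objects of the shape of the cone `C`. -/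
abbrev PreCone : Type u := Adjoin (fun _ : C.shape => y) (fun i => C.diagram.obj i)

/-- The canonical functor from `E` to `PreCone C y`. -/
abbrev PreCone.incl : E ⥤ PreCone C y := Adjoin.incl _ _

/-- The adjoined morphism `γ_i : y ⟶ φ i`. -/
abbrev PreCone.γ (i : C.shape) :
    (PreCone.incl C y).obj y ⟶ (PreCone.incl C y).obj (C.diagram.obj i) :=
  Adjoin.new (fun _ : C.shape => y) (fun i => C.diagram.obj i) i

/-- The relations `φ f ∘ γ_i ∼ γ_j`, for `f : i ⟶ j`. -/
inductive FreeConeRel : HomRel (PreCone C y)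
  | mk {i j : C.shape} (f : i ⟶ j) :
      FreeConeRel (PreCone.γ C y i ≫ (PreCone.incl C y).map (C.diagram.map f)) (PreCone.γ C y j)

/-- The category `E[y; C]`, obtained from `E` by freely adjoining a cone `γ` with vertex `y` over
the diagram of the cone `C`. -/
abbrev FreeCone : Type u := CategoryTheory.Quotient (FreeConeRel C y)

/-- The canonical functor `i : E ⥤ E[y; C]`. -/
def FreeCone.incl : E ⥤ FreeCone C y := PreCone.incl C y ⋙ CategoryTheory.Quotient.functor _

/-- The component `γ_i : y ⟶ φ i` of the adjoined cone. -/
def FreeCone.γ (i : C.shape) :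
    (FreeCone.incl C y).obj y ⟶ (FreeCone.incl C y).obj (C.diagram.obj i) :=
  (CategoryTheory.Quotient.functor (FreeConeRel C y)).map (PreCone.γ C y i)

/-- `E[y; C]` with one morphism `γ' : y ⟶ x` freely adjoined, where `x` is the vertex of `C`. -/
abbrev PreLift : Type u :=
  Adjoin (fun _ : PUnit.{u + 1} => (FreeCone.incl C y).obj y)
    (fun _ => (FreeCone.incl C y).obj C.vertex)

/-- The canonical functor from `E[y; C]` to `PreLift C y`. -/
abbrev PreLift.incl : FreeCone C y ⥤ PreLift C y := Adjoin.incl _ _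

/-- The adjoined morphism `γ' : y ⟶ x`. -/
abbrev PreLift.γ' :
    (PreLift.incl C y).obj ((FreeCone.incl C y).obj y) ⟶
      (PreLift.incl C y).obj ((FreeCone.incl C y).obj C.vertex) :=
  Adjoin.new (fun _ : PUnit.{u + 1} => (FreeCone.incl C y).obj y)
    (fun _ => (FreeCone.incl C y).obj C.vertex) PUnit.unit

/-- The relations `δ_i ∘ γ' ∼ γ_i`. -/
inductive FreeLiftRel : HomRel (PreLift C y)
  | mk (i : C.shape) :
      FreeLiftRel
        (PreLift.γ' C y ≫ (PreLift.incl C y).map ((FreeCone.incl C y).map (C.leg i)))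
        ((PreLift.incl C y).map (FreeCone.γ C y i))

/-- The category `E[y; C]'`, obtained from `E[y; C]` by freely adjoining a morphism `y ⟶ x` which
factors the cone `γ` through the cone `C`. -/
abbrev FreeLift : Type u := CategoryTheory.Quotient (FreeLiftRel C y)

/-- The canonical functor `r : E[y; C] ⥤ E[y; C]'`. -/
def FreeLift.incl : FreeCone C y ⥤ FreeLift C y := PreLift.incl C y ⋙ CategoryTheory.Quotient.functor _

end Generators

/-! ### The factorization system on the coslice category -/

section Orthogonality

variable {C : Type*} [Category* C]

/-- `f ↓ g`: every commutative square from `f` to `g` has exactly one lifting. -/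
def UniquelyOrthogonal {x y a b : C} (f : x ⟶ y) (g : a ⟶ b) : Prop :=
  ∀ (p : x ⟶ a) (q : y ⟶ b), p ≫ g = f ≫ q → ∃! h : y ⟶ a, f ≫ h = p ∧ h ≫ g = q

/-- The morphisms `g` such that `h ↓ g` for all `h` in `H`. -/
def rightOrthogonal (H : MorphismProperty C) : MorphismProperty C := fun _ _ g =>
  ∀ ⦃x y : C⦄ (h : x ⟶ y), H h → UniquelyOrthogonal h g

/-- The morphisms `f` such that `f ↓ h` for all `h` in `H`. -/
def leftOrthogonal (H : MorphismProperty C) : MorphismProperty C := fun _ _ f =>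
  ∀ ⦃x y : C⦄ (h : x ⟶ y), H h → UniquelyOrthogonal f h

end Orthogonality

section Coslice

variable (S : LimSk.{u})

/-- The coslice category `E/Cat`, where `E` is the underlying category of `S` and `Cat` is the
category of small categories. -/
abbrev Coslice : Type (u + 1) := Under S.cat

/-- The object `E ⥤ D` of `E/Cat` given by a functor. -/
abbrev Coslice.mk {D : Type u} [Category.{u} D] (F : S.cat ⥤ D) : Coslice S :=
  Under.mk (Y := Cat.of D) F.toCatHom

/-- The morphism `r : (E[y; α], i) ⟶ (E[y; α]', r ∘ i)` of `E/Cat`. -/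
def generator (p : S.cat × S.index) :
    Coslice.mk S (FreeCone.incl (S.cone p.2) p.1) ⟶
      Coslice.mk S (FreeCone.incl (S.cone p.2) p.1 ⋙ FreeLift.incl (S.cone p.2) p.1) :=
  Under.homMk (FreeLift.incl (S.cone p.2) p.1).toCatHom rfl

/-- The set `Ξ` of the morphisms `r : E[y; α] ⟶ E[y; α]'` of `E/Cat`, for all objects `y` of `E`
and all indices `α` of specified cones. -/
def generators : MorphismProperty (Coslice S) := MorphismProperty.ofHoms (generator S)

/-- The right class of the orthogonal factorization system on `E/Cat` generated by `Ξ`. -/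
def rightClass : MorphismProperty (Coslice S) := rightOrthogonal (generators S)

/-- The left class of the orthogonal factorization system on `E/Cat` generated by `Ξ`. -/
def leftClass : MorphismProperty (Coslice S) := leftOrthogonal (rightClass S)

/-- The identity functor of `E`, as an object of `E/Cat`. -/
abbrev Coslice.one : Coslice S := Coslice.mk S (𝟭 S.cat)

/-- The terminal object of `E/Cat`: the functor from `E` to the terminal category. -/
abbrev Coslice.point : Coslice S := Coslice.mk S (Functor.star.{u} S.cat)

/-- `Coslice.point S` is a terminal object. -/
def Coslice.isTerminalPoint : IsTerminal (Coslice.point S) :=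
  IsTerminal.ofUniqueHom
    (fun X => Under.homMk (Functor.star.{u} X.right).toCatHom
      (by apply Cat.ext; exact Functor.punit_ext' _ _))
    (fun X m => by
      apply Under.UnderMorphism.ext
      apply Cat.ext
      exact Functor.punit_ext' _ _)

/-- A factorization `E ⟶ fibr E ⟶ *` in `E/Cat` of the terminal map of `E`, with respect to the
orthogonal factorization system generated by `Ξ`. -/
abbrev FibrantReplacement : Type (u + 1) :=
  MorphismProperty.MapFactorizationData (leftClass S) (rightClass S)
    ((Coslice.isTerminalPoint S).from (Coslice.one S))

end Coslice

namespace FibrantReplacement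

variable {S : LimSk.{u}} (R : FibrantReplacement S)

/-- The category `fibr E`. -/
abbrev fibr : Cat.{u, u} := R.Z.right

/-- The functor `λ_!(E) : E ⥤ fibr E`. -/
abbrev lam : S.cat ⥤ R.fibr := R.i.right.toFunctor

/-- The family of the images under `λ_!(E)` of the specified cones of `S` contains the cone
`(e, 𝟏, *_e, id)` for every object `e` of `fibr E`. -/
def ContainsIdCones : Prop :=
  ∀ e : R.fibr, ∃ α, (S.cone α).map R.lam = SketchCone.idCone e

/-- The limit sketch `(fibr E, (C_α)_α)`, where `C_α` stands for its image under `λ_!(E)`. -/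
def sketch (h : R.ContainsIdCones) : LimSk.{u} where
  cat := R.fibr
  index := S.index
  cone α := (S.cone α).map R.lam
  exists_idCone := h

/-- The map `λ_!(E)` as a map of limit sketches; it is the identity on indices of cones. -/
def unit (h : R.ContainsIdCones) : S ⟶ R.sketch h where
  functor := R.lam
  onIndex := id
  map_cone _ := rfl

end FibrantReplacement

end LimitSketch

open LimitSketch

/-! Over the terminal object, orthogonality to `Ξ` says that each cone over the image of a specified
diagram, with vertex in the image of `E`, lifts uniquely (`rightClass_iff`). So `fibr E` must be the
universal category under `E` with this property.

It is built from models, the functors `E ⥤ Type` sending the specified cones to limit cones. These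
are the local objects for a small set of maps between presentable functors, so each corepresentable
functor has a reflection, the free model on one element (`exists_free_model`). Take the objects of
`E`, and as morphisms `a ⟶ b` the elements at `b` of the free model on `a`. Unique lifting is then
the model property, and freeness gives the universal property (`Realization.desc`,
`Realization.functor_ext`). A pullback argument (`leftOrthogonal_of_local`) puts the unit in the
left class.

Any other factorization has the same universal property, hence is a retract of this one under `E`,
so `λ_!(E)` is surjective on objects (`lam_obj_surjective`). Consequently the identity cones are
among the images, and unique lifting at objects of the image is unique lifting at all objects: the
sketch is realized. Functoriality and naturality follow from uniqueness of extensions. -/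

namespace LimitSketch

open Opposite

/-! ### Models of a family of cones, and free models -/

section Models

variable {E : Type u} [Category.{u} E]

/-- The functor `P` sends the cone `C` to a limit cone, in elementary terms. -/
def SketchCone.IsModelFor (C : SketchCone E) (P : E ⥤ Type u) : Prop :=
  ∀ p : ∀ i : C.shape, P.obj (C.diagram.obj i),
    (∀ ⦃i j : C.shape⦄ (f : i ⟶ j), P.map (C.diagram.map f) (p i) = p j) →
      ∃! q : P.obj C.vertex, ∀ i, P.map (C.leg i) q = p i

/-- A model of a family of cones: a functor which sends all of them to limit cones. -/
def IsModel {A : Type u} (K : A → SketchCone E) (P : E ⥤ Type u) : Prop :=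
  ∀ α, (K α).IsModelFor P

namespace SketchCone

variable (C : SketchCone E)

/-- The diagram of the functors corepresented by the objects of the diagram of a cone. -/
abbrev corepDiagram : (C.shape : Type u)ᵒᵖ ⥤ E ⥤ Type u := C.diagram.op ⋙ coyoneda

/-- The cocone of corepresented functors induced by a cone. -/
def corepCocone : Cocone C.corepDiagram where
  pt := coyoneda.obj (op C.vertex)
  ι :=
    { app i := coyoneda.map (C.leg i.unop).op
      naturality i j f := by
        have := C.cone.w f.unop
        dsimp
        rw [← Functor.map_comp, ← op_comp, Category.comp_id]
        exact congrArg (fun t => coyoneda.map t.op) this }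

/-- The comparison map whose local objects are the functors that send the cone to a limit cone. -/
noncomputable def corepComparison : colimit C.corepDiagram ⟶ coyoneda.obj (op C.vertex) :=
  colimit.desc _ C.corepCocone

lemma ι_corepComparison (i : C.shape) :
    colimit.ι C.corepDiagram (op i) ≫ C.corepComparison = coyoneda.map (C.leg i).op :=
  colimit.ι_desc _ _

/-- By Yoneda, maps out of the colimit of corepresentables are compatible families of elements, so
being a model is locality with respect to the comparison map. -/
lemma isModelFor_iff_bijective (P : E ⥤ Type u) :
    C.IsModelFor P ↔
      Function.Bijective fun g : coyoneda.obj (op C.vertex) ⟶ P => C.corepComparison ≫ g := by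
  have key (q : P.obj C.vertex) (g : colimit C.corepDiagram ⟶ P) :
      C.corepComparison ≫ coyonedaEquiv.symm q = g ↔
        ∀ i : C.shape, P.map (C.leg i) q = coyonedaEquiv (colimit.ι C.corepDiagram (op i) ≫ g) := by
    have h (i : C.shape) : P.map (C.leg i) q =
        coyonedaEquiv (colimit.ι C.corepDiagram (op i) ≫ C.corepComparison ≫
          coyonedaEquiv.symm q) := by
      rw [← Category.assoc, ι_corepComparison, ← coyonedaEquiv_naturality, Equiv.apply_symm_apply]
    constructor
    · rintro rfl i
      exact h i
    · intro H
      refine colimit.hom_ext fun i => coyonedaEquiv.injective ?_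
      exact (h i.unop).symm.trans (H i.unop)
  constructor
  · intro hP
    refine ⟨fun g₁ g₂ h => ?_, fun g => ?_⟩
    · obtain ⟨q₁, rfl⟩ := coyonedaEquiv.symm.surjective g₁
      obtain ⟨q₂, rfl⟩ := coyonedaEquiv.symm.surjective g₂
      have h₁ := (key q₁ _).1 h
      have h₂ := (key q₂ _).1 rfl
      refine congrArg _ ((hP (fun i => P.map (C.leg i) q₁) ?_).unique (fun i => rfl)
        (fun i => (h₂ i).trans (h₁ i).symm))
      intro i j f
      have := C.cone.w f
      exact (P.map_comp_apply (C.leg i) (C.diagram.map f) q₁).symm.trans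
        (congrArg (fun t => P.map t q₁) this)
    · obtain ⟨q, hq, -⟩ := hP (fun i => coyonedaEquiv (colimit.ι C.corepDiagram (op i) ≫ g)) (by
        intro i j f
        rw [coyonedaEquiv_naturality, ← colimit.w C.corepDiagram f.op, Category.assoc]
        rfl)
      exact ⟨coyonedaEquiv.symm q, (key q g).2 hq⟩
  · intro hP p hp
    -- A compatible family of elements is, by Yoneda, a cocone under the diagram of
    -- corepresentables.
    let c : Cocone C.corepDiagram :=
      { pt := P
        ι :=
          { app i := coyonedaEquiv.symm (p i.unop)
            naturality i j f := by
              have := coyonedaEquiv_symm_map (C.diagram.map f.unop) (p j.unop)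
              rw [hp] at this
              simpa using this.symm } }
    have hc (i : C.shape) : coyonedaEquiv (colimit.ι C.corepDiagram (op i) ≫ colimit.desc _ c) =
        p i := by
      rw [colimit.ι_desc]
      exact Equiv.apply_symm_apply _ _
    obtain ⟨g, hg⟩ := hP.2 (colimit.desc _ c)
    obtain ⟨q, rfl⟩ := coyonedaEquiv.symm.surjective g
    refine ⟨q, fun i => ((key q _).1 hg i).trans (hc i), fun q' hq' => ?_⟩
    refine coyonedaEquiv.symm.injective (hP.1 (Eq.trans ?_ hg.symm))
    exact (key q' _).2 fun i => (hq' i).trans (hc i).symm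

end SketchCone

/-- By Yoneda, mapping out of a corepresentable is evaluation at an object, and evaluation preserves
colimits. -/
instance isCardinalPresentable_coyoneda (κ : Cardinal.{u}) [Fact κ.IsRegular] (X : Eᵒᵖ) :
    IsCardinalPresentable (coyoneda.obj X : E ⥤ Type u) κ where
  preservesColimitOfShape J _ _ := by
    let e : coyoneda.obj (op (coyoneda.obj X)) ≅ (evaluation E (Type u)).obj X.unop :=
      NatIso.ofComponents (fun P => Equiv.toIso coyonedaEquiv)
        (fun f => by ext g; exact coyonedaEquiv_comp g f)
    exact preservesColimitsOfShape_of_natIso e.symm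

variable {A : Type u} (K : A → SketchCone E)

/-- The functor corepresented by an object has a reflection in the models of a family of cones. -/
theorem exists_free_model (a : E) :
    ∃ (M : E ⥤ Type u) (x : M.obj a), IsModel K M ∧
      ∀ (Q : E ⥤ Type u), IsModel K Q → ∀ q : Q.obj a, ∃! g : M ⟶ Q, g.app a x = q := by
  let W : MorphismProperty (E ⥤ Type u) := .ofHoms fun α => (K α).corepComparison
  have hloc (P : E ⥤ Type u) : W.isLocal P ↔ IsModel K P := by
    constructor
    · intro h α
      exact ((K α).isModelFor_iff_bijective P).2 (h _ ⟨α⟩)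
    · rintro h _ _ _ ⟨α⟩
      exact ((K α).isModelFor_iff_bijective P).1 (h α)
  -- `κ` bounds the number of arrows of every shape, so the colimits of corepresentables that are
  -- the sources of `W` are `κ`-presentable.
  obtain ⟨κ, hκ, hK⟩ := HasCardinalLT.exists_regular_cardinal_forall.{u}
    (fun α => Arrow ((K α).shape : Type u)ᵒᵖ)
  have : Fact κ.IsRegular := ⟨hκ⟩
  have : W.isLocal.ι.IsRightAdjoint := by
    refine W.isRightAdjoint_ι_isLocal κ ?_
    rintro _ _ _ ⟨α⟩
    refine ⟨?_, inferInstance⟩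
    have (k : ((K α).shape : Type u)ᵒᵖ) : IsCardinalPresentable ((K α).corepDiagram.obj k) κ :=
      isCardinalPresentable_coyoneda κ _
    exact isCardinalPresentable_of_isColimit _ (colimit.isColimit (K α).corepDiagram) κ (hK α)
  let adj := Adjunction.ofIsRightAdjoint W.isLocal.ι
  let L := W.isLocal.ι.leftAdjoint.obj (coyoneda.obj (op a))
  -- The generating element is the image of `𝟙 a` under the unit of the reflection.
  refine ⟨L.obj, coyonedaEquiv (adj.unit.app _), (hloc _).1 L.property, fun Q hQ q => ?_⟩
  let e := (adj.homEquiv (coyoneda.obj (op a)) ⟨Q, (hloc Q).2 hQ⟩).trans coyonedaEquiv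
  have he (g) : e g = g.hom.app a (coyonedaEquiv (adj.unit.app _)) := by
    simp only [e, Equiv.trans_apply, Adjunction.homEquiv_unit]
    exact coyonedaEquiv_comp _ _
  refine ⟨(e.symm q).hom, (he _).symm.trans (e.apply_symm_apply q), fun g hg => ?_⟩
  have h : e (ObjectProperty.homMk g) = q := (he _).trans hg
  rw [← h, e.symm_apply_apply]
  rfl

end Models

end LimitSketch

namespace LimitSketch

open Opposite

/-! ### The category whose morphisms are elements of free models -/

section Free

variable {E : Type u} [Category.{u} E] {A : Type u} (K : A → SketchCone E)

/-- The free model of a family of cones on an element at the object `a`. -/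
noncomputable def freeModel (a : E) : E ⥤ Type u := (exists_free_model K a).choose

/-- The generating element of `freeModel K a`. -/
noncomputable def gen (a : E) : (freeModel K a).obj a :=
  (exists_free_model K a).choose_spec.choose

lemma isModel_freeModel (a : E) : IsModel K (freeModel K a) :=
  (exists_free_model K a).choose_spec.choose_spec.1

variable {K}

lemma existsUnique_of_isModel {Q : E ⥤ Type u} (hQ : IsModel K Q) {a : E} (q : Q.obj a) :
    ∃! g : freeModel K a ⟶ Q, g.app a (gen K a) = q :=
  (exists_free_model K a).choose_spec.choose_spec.2 Q hQ q

/-- The map from the free model given by an element of a model. -/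
noncomputable def extend {Q : E ⥤ Type u} (hQ : IsModel K Q) {a : E} (q : Q.obj a) :
    freeModel K a ⟶ Q :=
  (existsUnique_of_isModel hQ q).choose

@[simp]
lemma extend_gen {Q : E ⥤ Type u} (hQ : IsModel K Q) {a : E} (q : Q.obj a) :
    (extend hQ q).app a (gen K a) = q :=
  (existsUnique_of_isModel hQ q).choose_spec.1

lemma freeModel_hom_ext {Q : E ⥤ Type u} (hQ : IsModel K Q) {a : E} {f g : freeModel K a ⟶ Q}
    (h : f.app a (gen K a) = g.app a (gen K a)) : f = g :=
  (existsUnique_of_isModel hQ _).unique h rfl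

/-- The objects of the free category which realizes a family of cones. -/
@[nolint unusedArguments]
structure Realization (_K : A → SketchCone E) : Type u where
  /-- the underlying object -/
  ob : E

namespace Realization

/-- A morphism `a ⟶ b` amounts to a map of models from the free model on `b` to that on `a`;
composition is composition of these maps in the reverse order, and the laws follow by comparing
generators. -/
noncomputable instance : Category.{u} (Realization K) where
  Hom a b := (freeModel K a.ob).obj b.ob
  id a := gen K a.ob
  comp {a _ c} f g := (extend (isModel_freeModel K a.ob) f).app c.ob g
  id_comp {a b} f := by
    have : extend (isModel_freeModel K a.ob) (gen K a.ob) = 𝟙 _ :=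
      freeModel_hom_ext (isModel_freeModel K a.ob) (by simp)
    simp [this]
  comp_id f := extend_gen _ f
  assoc {a b c d} f g h := by
    have : extend (isModel_freeModel K a.ob) ((extend (isModel_freeModel K a.ob) f).app c.ob g) =
        extend (isModel_freeModel K b.ob) g ≫ extend (isModel_freeModel K a.ob) f :=
      freeModel_hom_ext (isModel_freeModel K a.ob) (by simp)
    rw [this]
    rfl

lemma comp_def {a b c : Realization K} (f : a ⟶ b) (g : b ⟶ c) :
    f ≫ g = (extend (isModel_freeModel K a.ob) f).app c.ob g := rfl

variable (K) in
/-- The canonical functor to the free category which realizes a family of cones. -/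
noncomputable def unit : E ⥤ Realization K where
  obj a := ⟨a⟩
  map {a b} f := (freeModel K a).map f (gen K a)
  map_id a :=
     ConcreteCategory.congr_hom ((freeModel K a).map_id a) (gen K a)
  map_comp {a b c} f g := by
    rw [comp_def, NatTrans.naturality_apply, extend_gen, Functor.map_comp_apply]

lemma comp_unit_map {a : Realization K} {b c : E} (f : a ⟶ (unit K).obj b) (g : b ⟶ c) :
    f ≫ (unit K).map g = (freeModel K a.ob).map g f :=
  (NatTrans.naturality_apply (extend (isModel_freeModel K a.ob) f) g (gen K b)).trans
    (congrArg _ (extend_gen _ _))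

end Realization

/-- A functor `G` has unique liftings for a cone `C` at the object `y` if every cone over the image
of the diagram of `C`, with vertex `G y`, factors uniquely through the image of `C`. -/
def LiftsUniquely (C : SketchCone E) (y : E) {D : Type*} [Category* D] (G : E ⥤ D) : Prop :=
  ∀ s : ∀ i : C.shape, G.obj y ⟶ G.obj (C.diagram.obj i),
    (∀ ⦃i j : C.shape⦄ (f : i ⟶ j), s i ≫ G.map (C.diagram.map f) = s j) →
      ∃! l : G.obj y ⟶ G.obj C.vertex, ∀ i, l ≫ G.map (C.leg i) = s i

variable (K) in
/-- A functor has unique liftings for all cones of a family, at all objects. -/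
def RealizesAtImage {D : Type*} [Category* D] (G : E ⥤ D) : Prop :=
  ∀ (y : E) (α : A), LiftsUniquely (K α) y G

variable (K) in
-- Composing with a morphism of `E` is the action of the free model (`comp_unit_map`), which turns
-- the claim into the model property of `freeModel K y`.
lemma realizesAtImage_unit : RealizesAtImage K (Realization.unit K) := by
  intro y α s hs
  simp only [Realization.comp_unit_map] at hs ⊢
  exact isModel_freeModel K y α s hs

/-! ### Universal property of the realization -/

section Universal

variable {D : Type u} [Category.{u} D]

/-- The two conditions agree by unfolding. This makes freeness applicable to the morphism sets of
`D`. -/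
lemma RealizesAtImage.isModel {G : E ⥤ D} (hG : RealizesAtImage K G) (a : E) :
    IsModel K (G ⋙ coyoneda.obj (op (G.obj a))) := fun α => hG a α

variable {G : E ⥤ D} (hG : RealizesAtImage K G)

/-- The action on morphisms of the functor induced on the free category which realizes a family
of cones. -/
noncomputable def Realization.descHom (a : E) :
    freeModel K a ⟶ G ⋙ coyoneda.obj (op (G.obj a)) :=
  extend (hG.isModel a) (𝟙 (G.obj a) : G.obj a ⟶ G.obj a)

lemma Realization.descHom_gen (a : E) :
    (descHom hG a).app a (gen K a) = (𝟙 (G.obj a) : G.obj a ⟶ G.obj a) :=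
  extend_gen _ _

/-- The map between functors of morphisms given by precomposition with `f`. -/
def precompHom (G : E ⥤ D) {a b : E} (f : G.obj a ⟶ G.obj b) :
    G ⋙ coyoneda.obj (op (G.obj b)) ⟶ G ⋙ coyoneda.obj (op (G.obj a)) :=
  Functor.whiskerLeft G (coyoneda.map f.op)

/-- The functor induced on the free category which realizes a family of cones. -/
noncomputable def Realization.desc : Realization K ⥤ D where
  obj a := G.obj a.ob
  map {a b} f := (descHom hG a.ob).app b.ob f
  map_id a := descHom_gen hG a.ob
  map_comp {a b c} f g := by
    -- Both sides are maps from the free model on `b` to a model; at the generator both give the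
    -- image of `f`.
    have h : extend (isModel_freeModel K a.ob) f ≫ descHom hG a.ob =
        descHom hG b.ob ≫ precompHom G ((descHom hG a.ob).app b.ob f) := by
      refine freeModel_hom_ext (hG.isModel _) ?_
      rw [NatTrans.comp_app_apply, extend_gen, NatTrans.comp_app_apply, descHom_gen]
      exact (Category.comp_id _).symm
    exact congrArg (fun t => t.app c.ob g) h

lemma Realization.unit_desc : unit K ⋙ desc hG = G :=
  Functor.hext (fun _ => rfl) fun a _ f => heq_of_eq <|
    (NatTrans.naturality_apply (descHom hG a) f (gen K a)).trans <|
      (congrArg _ (descHom_gen hG a)).trans (Category.id_comp (G.map f))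

lemma eqToHom_conj_comp {X X' Y Y' Z Z' : D} (hX : X = X') (hY : Y = Y') (hZ : Z = Z')
    (f : X' ⟶ Y') (g : Y' ⟶ Z') :
    eqToHom hX ≫ (f ≫ g) ≫ eqToHom hZ.symm =
      (eqToHom hX ≫ f ≫ eqToHom hY.symm) ≫ eqToHom hY ≫ g ≫ eqToHom hZ.symm := by
  simp

/-- Every object comes from `E`. On morphisms out of `a`, both functors give maps from the free
model on `a` to the same model, and these agree at the generator, which is an identity morphism. -/
lemma Realization.functor_ext {H₁ H₂ : Realization K ⥤ D}
    (hH : RealizesAtImage K (unit K ⋙ H₁)) (h : unit K ⋙ H₁ = unit K ⋙ H₂) : H₁ = H₂ := by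
  have hobj (a : E) : H₁.obj ⟨a⟩ = H₂.obj ⟨a⟩ := Functor.congr_obj h a
  let t₁ (a : E) : freeModel K a ⟶ (unit K ⋙ H₁) ⋙ coyoneda.obj (op ((unit K ⋙ H₁).obj a)) :=
    { app b := ↾fun f => H₁.map (X := ⟨a⟩) (Y := ⟨b⟩) f
      naturality b c g := by
        ext f
        have := comp_unit_map (a := ⟨a⟩) f g
        exact (congrArg H₁.map this).symm.trans (H₁.map_comp _ _) }
  -- The values of `H₁` and `H₂` on objects are only propositionally equal, so `H₂` is conjugated by
  -- `eqToHom` to land in the model given by `H₁`.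
  let t₂ (a : E) : freeModel K a ⟶ (unit K ⋙ H₁) ⋙ coyoneda.obj (op ((unit K ⋙ H₁).obj a)) :=
    { app b := ↾fun f =>
        eqToHom (hobj a) ≫ H₂.map (X := ⟨a⟩) (Y := ⟨b⟩) f ≫ eqToHom (hobj b).symm
      naturality b c g := by
        ext f
        have h₁ := comp_unit_map (a := ⟨a⟩) f g
        have h₂ : H₁.map ((unit K).map g) = _ := Functor.congr_hom h g
        have h₃ : H₂.map (X := ⟨a⟩) (Y := ⟨c⟩) ((freeModel K a).map g f) =
            H₂.map (X := ⟨a⟩) (Y := ⟨b⟩) f ≫ H₂.map ((unit K).map g) :=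
          (congrArg H₂.map h₁).symm.trans (H₂.map_comp _ _)
        change eqToHom (hobj a) ≫ H₂.map (X := ⟨a⟩) (Y := ⟨c⟩) ((freeModel K a).map g f) ≫
          eqToHom (hobj c).symm = (eqToHom (hobj a) ≫ H₂.map (X := ⟨a⟩) (Y := ⟨b⟩) f ≫
          eqToHom (hobj b).symm) ≫ H₁.map ((unit K).map g)
        refine (congrArg (fun t => eqToHom (hobj a) ≫ t ≫ eqToHom (hobj c).symm) h₃).trans
          (Eq.trans ?_ (congrArg (fun t => (eqToHom (hobj a) ≫ H₂.map (X := ⟨a⟩) (Y := ⟨b⟩) f ≫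
            eqToHom (hobj b).symm) ≫ t) h₂).symm)
        exact eqToHom_conj_comp (hobj a) (hobj b) (hobj c) _ _ }
  have ht (a : E) : t₁ a = t₂ a := by
    refine freeModel_hom_ext (hH.isModel a) ?_
    change H₁.map (𝟙 (⟨a⟩ : Realization K)) =
      eqToHom (hobj a) ≫ H₂.map (𝟙 (⟨a⟩ : Realization K)) ≫ eqToHom (hobj a).symm
    simp
  exact CategoryTheory.Functor.ext (fun a => hobj a.ob) fun a b f => congrArg (fun t => t.app b.ob f) (ht a.ob)

end Universal

end Free

end LimitSketch

namespace LimitSketch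

/-! ### Universal properties of `E[y; C]` and `E[y; C]'` -/

section AdjoinUniversal

variable {E : Type u} [Category.{u} E] {D : Type u} [Category.{u} D]

namespace Adjoin

variable {K : Type u} {s t : K → E}

/-- The prefunctor which corresponds to a functor on `E` and images of the adjoined morphisms. -/
def edgeMap (G : E ⥤ D) (m : ∀ k, G.obj (s k) ⟶ G.obj (t k)) {a b : E} :
    AdjoinEdge s t a b → (G.obj a ⟶ G.obj b)
  | .of f => G.map f
  | .new k => m k

/-- The functor on the free category given by a functor and images of the adjoined morphisms. -/
def pathDesc (G : E ⥤ D) (m : ∀ k, G.obj (s k) ⟶ G.obj (t k)) : Paths (AdjoinGraph s t) ⥤ D :=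
  Paths.lift { obj := fun a => G.obj a, map := fun e => edgeMap G m e }

lemma pathDesc_path (G : E ⥤ D) (m : ∀ k, G.obj (s k) ⟶ G.obj (t k)) {a b : E}
    (e : AdjoinEdge s t a b) : (pathDesc G m).map e.path = edgeMap G m e :=
  Paths.lift_toPath _ _

/-- The functor on `Adjoin s t` given by a functor and images of the adjoined morphisms. -/
def desc (G : E ⥤ D) (m : ∀ k, G.obj (s k) ⟶ G.obj (t k)) : Adjoin s t ⥤ D :=
  CategoryTheory.Quotient.lift _ (pathDesc G m) (by
    rintro _ _ _ _ (a | ⟨f, g⟩)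
    · rw [pathDesc_path]
      exact (G.map_id a).trans ((pathDesc G m).map_id _).symm
    · rw [Functor.map_comp, pathDesc_path, pathDesc_path, pathDesc_path]
      exact G.map_comp f g)

lemma incl_desc (G : E ⥤ D) (m : ∀ k, G.obj (s k) ⟶ G.obj (t k)) :
    incl s t ⋙ desc G m = G :=
  Functor.hext (fun _ => rfl) fun _ _ f => heq_of_eq (pathDesc_path G m (.of f))

lemma desc_map_incl (G : E ⥤ D) (m : ∀ k, G.obj (s k) ⟶ G.obj (t k)) {a b : E} (f : a ⟶ b) :
    (desc G m).map ((incl s t).map f) = G.map f :=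
  pathDesc_path G m (.of f)

lemma desc_map_new (G : E ⥤ D) (m : ∀ k, G.obj (s k) ⟶ G.obj (t k)) (k : K) :
    (desc G m).map (new s t k) = m k :=
  pathDesc_path G m (.new k)

lemma functor_ext {H₁ H₂ : Adjoin s t ⥤ D} (h : incl s t ⋙ H₁ = incl s t ⋙ H₂)
    (hnew : ∀ k, H₁.map (new s t k) ≍ H₂.map (new s t k)) : H₁ = H₂ := by
  have hedge {a b : E} (e : AdjoinEdge s t a b) : H₁.map (edge s t e) ≍ H₂.map (edge s t e) := by
    cases e with
    | of f => exact Functor.hcongr_hom h f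
    | new k => exact hnew k
  exact CategoryTheory.Quotient.lift_unique' _ _ _
    (Paths.ext_functor (funext fun a => Functor.congr_obj h a)
      fun a b e => (conj_eqToHom_iff_heq' _ _ _ _).2 (hedge e))

end Adjoin

end AdjoinUniversal

section

variable {E : Type u} [Category.{u} E] {D : Type u} [Category.{u} D] (C : SketchCone E) (y : E)

namespace FreeCone

/-- The functor on `E[y; C]` given by a functor `G` and a cone with vertex `G y`. -/
def desc (G : E ⥤ D) (s : ∀ i : C.shape, G.obj y ⟶ G.obj (C.diagram.obj i))
    (hs : ∀ ⦃i j : C.shape⦄ (f : i ⟶ j), s i ≫ G.map (C.diagram.map f) = s j) :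
    FreeCone C y ⥤ D :=
  CategoryTheory.Quotient.lift _ (Adjoin.desc G s) (by
    rintro _ _ _ _ ⟨f⟩
    rw [Functor.map_comp, Adjoin.desc_map_incl, Adjoin.desc_map_new, Adjoin.desc_map_new]
    exact hs f)

lemma incl_desc (G : E ⥤ D) (s : ∀ i : C.shape, G.obj y ⟶ G.obj (C.diagram.obj i))
    (hs : ∀ ⦃i j : C.shape⦄ (f : i ⟶ j), s i ≫ G.map (C.diagram.map f) = s j) :
    incl C y ⋙ desc C y G s hs = G :=
  Adjoin.incl_desc G s

lemma desc_map_γ (G : E ⥤ D) (s : ∀ i : C.shape, G.obj y ⟶ G.obj (C.diagram.obj i))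
    (hs : ∀ ⦃i j : C.shape⦄ (f : i ⟶ j), s i ≫ G.map (C.diagram.map f) = s j) (i : C.shape) :
    (desc C y G s hs).map (γ C y i) = s i :=
  Adjoin.desc_map_new G s i

lemma γ_comp {i j : C.shape} (f : i ⟶ j) :
    γ C y i ≫ (incl C y).map (C.diagram.map f) = γ C y j :=
  CategoryTheory.Quotient.sound _ (FreeConeRel.mk f)

end FreeCone

namespace FreeLift

/-- The adjoined morphism in `E[y; C]'`. -/
def lift : (incl C y).obj ((FreeCone.incl C y).obj y) ⟶
    (incl C y).obj ((FreeCone.incl C y).obj C.vertex) :=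
  (CategoryTheory.Quotient.functor (FreeLiftRel C y)).map (PreLift.γ' C y)

lemma lift_comp (i : C.shape) :
    lift C y ≫ (incl C y).map ((FreeCone.incl C y).map (C.leg i)) =
      (incl C y).map (FreeCone.γ C y i) :=
  CategoryTheory.Quotient.sound _ (FreeLiftRel.mk i)

variable (G : FreeCone C y ⥤ D)
  (l : G.obj ((FreeCone.incl C y).obj y) ⟶ G.obj ((FreeCone.incl C y).obj C.vertex))

/-- The functor on `E[y; C]'` given by a functor on `E[y; C]` and a lifting of the image of the
universal cone. -/
def desc (hl : ∀ i, l ≫ G.map ((FreeCone.incl C y).map (C.leg i)) = G.map (FreeCone.γ C y i)) :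
    FreeLift C y ⥤ D :=
  CategoryTheory.Quotient.lift _ (Adjoin.desc G fun _ => l) (by
    rintro _ _ _ _ ⟨i⟩
    rw [Functor.map_comp, Adjoin.desc_map_incl, Adjoin.desc_map_incl, Adjoin.desc_map_new]
    exact hl i)

variable (hl : ∀ i, l ≫ G.map ((FreeCone.incl C y).map (C.leg i)) = G.map (FreeCone.γ C y i))

lemma incl_desc : incl C y ⋙ desc C y G l hl = G :=
  Adjoin.incl_desc G _

lemma desc_map_lift : (desc C y G l hl).map (lift C y) = l :=
  Adjoin.desc_map_new G (fun _ => l) PUnit.unit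

variable {C y} in
lemma functor_ext {H₁ H₂ : FreeLift C y ⥤ D} (h : incl C y ⋙ H₁ = incl C y ⋙ H₂)
    (hl : H₁.map (lift C y) ≍ H₂.map (lift C y)) : H₁ = H₂ :=
  CategoryTheory.Quotient.lift_unique' _ _ _ (Adjoin.functor_ext h fun _ => hl)

end FreeLift

-- Extensions of `K` correspond to liftings of the cone `K γ`: the image of the adjoined morphism
-- determines the extension.
variable {C y} in
lemma existsUnique_extension_of_liftsUniquely {K : FreeCone C y ⥤ D}
    (h : LiftsUniquely C y (FreeCone.incl C y ⋙ K)) :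
    ∃! H : FreeLift C y ⥤ D, FreeLift.incl C y ⋙ H = K := by
  obtain ⟨l, hl, huniq⟩ := h (fun i => K.map (FreeCone.γ C y i)) fun i j f =>
    (K.map_comp _ _).symm.trans (congrArg K.map (FreeCone.γ_comp C y f))
  refine ⟨FreeLift.desc C y K l hl, FreeLift.incl_desc C y K l hl, ?_⟩
  rintro H rfl
  refine FreeLift.functor_ext (FreeLift.incl_desc C y _ l hl).symm
    (heq_of_eq (Eq.trans ?_ (FreeLift.desc_map_lift C y (FreeLift.incl C y ⋙ H) l hl).symm))
  exact huniq _ fun i =>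
    (H.map_comp _ _).symm.trans (congrArg H.map (FreeLift.lift_comp C y i))

-- A cone `s` over the image of the diagram is the image of `γ` under a functor on `E[y; C]`, so
-- extending that functor amounts to lifting `s`.
variable {C y} in
lemma liftsUniquely_of_existsUnique_extension {G : E ⥤ D}
    (h : ∀ K : FreeCone C y ⥤ D, FreeCone.incl C y ⋙ K = G →
      ∃! H : FreeLift C y ⥤ D, FreeLift.incl C y ⋙ H = K) :
    LiftsUniquely C y G := by
  intro s hs
  have hK := FreeCone.incl_desc C y G s hs
  have hKmap {a b : E} (f : a ⟶ b) :
      (FreeCone.desc C y G s hs).map ((FreeCone.incl C y).map f) = G.map f :=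
    Adjoin.desc_map_incl G s f
  have hKγ := FreeCone.desc_map_γ C y G s hs
  -- Stated for a variable `K`, so that the equality of functors can be eliminated by substitution.
  have aux (K : FreeCone C y ⥤ D) (H : FreeLift C y ⥤ D) (hH : FreeLift.incl C y ⋙ H = K) :
      ∃ l, ∀ i, l ≫ K.map ((FreeCone.incl C y).map (C.leg i)) = K.map (FreeCone.γ C y i) := by
    subst hH
    exact ⟨H.map (FreeLift.lift C y), fun i =>
      (H.map_comp _ _).symm.trans (congrArg H.map (FreeLift.lift_comp C y i))⟩
  have hleg (l : G.obj y ⟶ G.obj C.vertex) : (∀ i, l ≫ G.map (C.leg i) = s i) →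
      ∀ i, l ≫ (FreeCone.desc C y G s hs).map ((FreeCone.incl C y).map (C.leg i)) =
        (FreeCone.desc C y G s hs).map (FreeCone.γ C y i) := fun hl i =>
    (congrArg (l ≫ ·) (hKmap (C.leg i))).trans ((hl i).trans (hKγ i).symm)
  obtain ⟨H, hH, huniq⟩ := h _ hK
  obtain ⟨l, hl⟩ := aux _ H hH
  refine ⟨l, fun i => (congrArg (l ≫ ·) (hKmap (C.leg i))).symm.trans ((hl i).trans (hKγ i)), ?_⟩
  intro l' hl'
  -- Both liftings define extensions, which coincide; evaluating at the adjoined morphism gives `l'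
  -- = l`.
  have h' := huniq _ (FreeLift.incl_desc C y _ l' (hleg l' hl'))
  have h'' := huniq _ (FreeLift.incl_desc C y _ l hl)
  have e₁ := FreeLift.desc_map_lift C y (FreeCone.desc C y G s hs) l' (hleg l' hl')
  have e₂ := FreeLift.desc_map_lift C y (FreeCone.desc C y G s hs) l hl
  have e₃ := Functor.hcongr_hom (h'.trans h''.symm) (FreeLift.lift C y)
  exact (e₁.symm.trans (eq_of_heq e₃)).trans e₂

end

/-! ### Orthogonality to `Ξ` over the terminal object -/

section Coslice

variable (S : LimSk.{u})

/-- The underlying functor of an object of the coslice category. -/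
abbrev Coslice.functor {S : LimSk.{u}} (X : Coslice S) : S.cat ⥤ X.right := X.hom.toFunctor

variable {S} in
lemma Coslice.comp_functor {X Y : Coslice S} (f : X ⟶ Y) :
    X.functor ⋙ f.right.toFunctor = Y.functor :=
  congrArg Cat.Hom.toFunctor (Under.w f)

variable {S} in
/-- Morphisms of the coslice category are functors under `E`. -/
abbrev Coslice.homMk {X Y : Coslice S} (F : X.right ⥤ Y.right) (h : X.functor ⋙ F = Y.functor) :
    X ⟶ Y :=
  Under.homMk F.toCatHom (Cat.Hom.ext h)

variable {S} in
lemma Coslice.hom_ext {X Y : Coslice S} {f g : X ⟶ Y}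
    (h : f.right.toFunctor = g.right.toFunctor) : f = g :=
  Under.UnderMorphism.ext (Cat.Hom.ext h)

variable {S} in
lemma uniquelyOrthogonal_generator {X : Coslice S} (g : X ⟶ Coslice.point S) {y : S.cat}
    {α : S.index} (h : LiftsUniquely (S.cone α) y X.functor) :
    UniquelyOrthogonal (generator S (y, α)) g := by
  rintro p q -
  have hp := Coslice.comp_functor p
  obtain ⟨H, hH, huniq⟩ := existsUnique_extension_of_liftsUniquely (C := S.cone α) (y := y)
    (K := p.right.toFunctor) (by
      have : FreeCone.incl (S.cone α) y ⋙ p.right.toFunctor = X.functor := hp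
      rw [this]
      exact h)
  have hw : (FreeCone.incl (S.cone α) y ⋙ FreeLift.incl (S.cone α) y) ⋙ H = X.functor :=
    (congrArg (FreeCone.incl (S.cone α) y ⋙ ·) hH).trans hp
  refine ⟨Coslice.homMk
    (X := Coslice.mk S (FreeCone.incl (S.cone α) y ⋙ FreeLift.incl (S.cone α) y)) H hw,
    ⟨Coslice.hom_ext hH, (Coslice.isTerminalPoint S).hom_ext _ _⟩, fun H' hH' => ?_⟩
  exact Coslice.hom_ext (huniq _ (congrArg (fun t => t.right.toFunctor) hH'.1))

-- Over the terminal object the lower triangle of a lifting problem commutes automatically, leaving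
-- only unique extension along the generators.
variable {S} in
theorem rightClass_iff {X : Coslice S} (g : X ⟶ Coslice.point S) :
    rightClass S g ↔ RealizesAtImage S.cone X.functor := by
  constructor
  · intro h y α
    refine liftsUniquely_of_existsUnique_extension fun K hK => ?_
    obtain ⟨H, ⟨hH, -⟩, huniq⟩ := h _ ⟨(y, α)⟩
      (Coslice.homMk (X := Coslice.mk S (FreeCone.incl (S.cone α) y)) K hK)
      ((Coslice.isTerminalPoint S).from _) ((Coslice.isTerminalPoint S).hom_ext _ _)
    refine ⟨H.right.toFunctor, congrArg (fun t => t.right.toFunctor) hH, fun H' hH' => ?_⟩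
    have hw : (FreeCone.incl (S.cone α) y ⋙ FreeLift.incl (S.cone α) y) ⋙ H' = X.functor :=
      (congrArg (FreeCone.incl (S.cone α) y ⋙ ·) hH').trans hK
    exact congrArg (fun t => t.right.toFunctor) <| huniq (Coslice.homMk
      (X := Coslice.mk S (FreeCone.incl (S.cone α) y ⋙ FreeLift.incl (S.cone α) y)) H' hw)
      ⟨Coslice.hom_ext hH', (Coslice.isTerminalPoint S).hom_ext _ _⟩
  · rintro h _ _ _ ⟨y, α⟩
    exact uniquelyOrthogonal_generator g (h y α)

end Coslice

end LimitSketch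

namespace LimitSketch

/-! ### Left class and local objects -/

section Orthogonality

variable {C : Type*} [Category* C]

lemma rightOrthogonal_comp {H : MorphismProperty C} {a b c : C} {g : a ⟶ b} {g' : b ⟶ c}
    (hg : rightOrthogonal H g) (hg' : rightOrthogonal H g') : rightOrthogonal H (g ≫ g') := by
  intro x y h hh p q w
  obtain ⟨k, ⟨hk₁, hk₂⟩, huniq⟩ := hg' h hh (p ≫ g) q (by simpa using w)
  obtain ⟨l, ⟨hl₁, hl₂⟩, huniq'⟩ := hg h hh p k hk₁.symm
  refine ⟨l, ⟨hl₁, by rw [reassoc_of% hl₂, hk₂]⟩, fun l' hl' => huniq' l' ⟨hl'.1, ?_⟩⟩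
  exact huniq _ ⟨by rw [reassoc_of% hl'.1], by simpa using hl'.2⟩

lemma rightOrthogonal_pullback {H : MorphismProperty C} {a b c d : C} {f : a ⟶ b} {g : a ⟶ c}
    {g' : b ⟶ d} {f' : c ⟶ d} (sq : IsPullback f g g' f') (hg' : rightOrthogonal H g') :
    rightOrthogonal H g := by
  intro x y h hh p q w
  obtain ⟨k, ⟨hk₁, hk₂⟩, huniq⟩ := hg' h hh (p ≫ f) (q ≫ f')
    (by rw [Category.assoc, sq.w, reassoc_of% w])
  refine ⟨sq.lift k q hk₂, ⟨sq.hom_ext (by simpa using hk₁) (by simpa using w.symm), by simp⟩,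
    fun l hl => sq.hom_ext ?_ (by simpa using hl.2)⟩
  rw [sq.lift_fst]
  exact huniq _ ⟨by rw [reassoc_of% hl.1], by rw [Category.assoc, sq.w, reassoc_of% hl.2]⟩

/-- A map to a local object belongs to the left class as soon as it is orthogonal to all local
objects. -/
lemma leftOrthogonal_of_local [HasPullbacks C] {H : MorphismProperty C} {pt : C}
    (hpt : IsTerminal pt) {x z : C} (i : x ⟶ z) (hz : rightOrthogonal H (hpt.from z))
    (hi : ∀ a : C, rightOrthogonal H (hpt.from a) → ∀ f : x ⟶ a, ∃! g : z ⟶ a, i ≫ g = f) :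
    leftOrthogonal (rightOrthogonal H) i := by
  intro a b g hg p q w
  -- Diagonals of the square are sections of the pullback of `g` along `q` that extend `(p, i)`. The
  -- pullback is local, since `z` is.
  have sq := IsPullback.of_hasPullback g q
  have hP : rightOrthogonal H (hpt.from (pullback g q)) := by
    rw [hpt.hom_ext (hpt.from (pullback g q)) (pullback.snd g q ≫ hpt.from z)]
    exact rightOrthogonal_comp (rightOrthogonal_pullback sq hg) hz
  obtain ⟨s, hs, huniq⟩ := hi _ hP (sq.lift p i w)
  -- Both are extensions of `i` along itself into the local object `z`.
  have hsnd : s ≫ pullback.snd g q = 𝟙 z :=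
    (hi z hz i).unique (by rw [reassoc_of% hs, sq.lift_snd]) (Category.comp_id _)
  refine ⟨s ≫ pullback.fst g q, ⟨by rw [reassoc_of% hs, sq.lift_fst], ?_⟩, fun l hl => ?_⟩
  · rw [Category.assoc, sq.w, reassoc_of% hsnd]
  · have : sq.lift l (𝟙 z) (by rw [hl.2, Category.id_comp]) = s :=
      huniq _ (sq.hom_ext (by simpa using hl.1) (by simp))
    rw [← this, sq.lift_fst]

end Orthogonality

/-! ### Existence of the factorization -/

section Existence

variable (S : LimSk.{u})

/-- The canonical functor to the free category which realizes the cones of a limit sketch. -/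
noncomputable abbrev Coslice.realization : Coslice S :=
  Coslice.mk S (Realization.unit S.cone)

/-- The canonical functor, as a morphism of the coslice category. -/
noncomputable def Coslice.toRealization : Coslice.one S ⟶ Coslice.realization S :=
  Coslice.homMk (Realization.unit S.cone) (Functor.id_comp _)

/-- The factorization of the terminal map through the free category which realizes the cones. -/
noncomputable def standardReplacement : FibrantReplacement S where
  Z := Coslice.realization S
  i := Coslice.toRealization S
  p := (Coslice.isTerminalPoint S).from _
  fac := (Coslice.isTerminalPoint S).hom_ext _ _
  hp := (rightClass_iff _).2 (realizesAtImage_unit S.cone)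
  hi := by
    refine leftOrthogonal_of_local (Coslice.isTerminalPoint S) _
      ((rightClass_iff _).2 (realizesAtImage_unit S.cone)) fun a ha f => ?_
    have ha' : RealizesAtImage S.cone (Coslice.functor a) := (rightClass_iff _).1 ha
    have h := Realization.unit_desc ha'
    have hf {g : Coslice.one S ⟶ a} : g.right.toFunctor = a.functor :=
      (Functor.id_comp _).symm.trans (Coslice.comp_functor g)
    refine ⟨Coslice.homMk (X := Coslice.realization S) (Realization.desc ha') h,
      Coslice.hom_ext (h.trans hf.symm), fun g _ => Coslice.hom_ext ?_⟩
    have hg : Realization.unit S.cone ⋙ g.right.toFunctor = a.functor := Coslice.comp_functor g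
    exact Realization.functor_ext (by rw [hg]; exact ha') (hg.trans h.symm)

end Existence

/-! ### Properties of an arbitrary factorization -/

namespace FibrantReplacement

variable {S : LimSk.{u}} (R : FibrantReplacement S)

lemma hom_functor : Coslice.functor R.Z = R.lam :=
  (Coslice.comp_functor R.i).symm.trans (Functor.id_comp _)

lemma realizesAtImage_lam : RealizesAtImage S.cone R.lam := by
  rw [← R.hom_functor]
  exact (rightClass_iff _).1 R.hp

/-- The universal property of `λ_!(E)`. -/
theorem existsUnique_extension {D : Type u} [Category.{u} D] {G : S.cat ⥤ D}
    (hG : RealizesAtImage S.cone G) : ∃! H : R.fibr ⥤ D, R.lam ⋙ H = G := by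
  let Y := Coslice.mk S G
  let f : Coslice.one S ⟶ Y := Coslice.homMk (X := Coslice.one S) G (Functor.id_comp _)
  obtain ⟨H, ⟨hH, -⟩, huniq⟩ := R.hi ((Coslice.isTerminalPoint S).from Y)
    ((rightClass_iff _).2 hG) f R.p ((Coslice.isTerminalPoint S).hom_ext _ _)
  refine ⟨H.right.toFunctor, congrArg (fun t => t.right.toFunctor) hH, fun H' hH' => ?_⟩
  have hw : Coslice.functor R.Z ⋙ H' = G := by rw [R.hom_functor, hH']
  exact congrArg (fun t => t.right.toFunctor) <| huniq (Coslice.homMk (Y := Y) H' hw)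
    ⟨Coslice.hom_ext hH', (Coslice.isTerminalPoint S).hom_ext _ _⟩

lemma functor_ext {D : Type u} [Category.{u} D] {H₁ H₂ : R.fibr ⥤ D}
    (hH : RealizesAtImage S.cone (R.lam ⋙ H₂)) (h : R.lam ⋙ H₁ = R.lam ⋙ H₂) : H₁ = H₂ :=
  (R.existsUnique_extension hH).unique h rfl

/-- The universal properties give functors `U` to the realization and `V` back, under `E`, with `U ⋙
V` the identity. So `e` is `V (U e)`, and every object of the realization comes from `E`. -/
theorem lam_obj_surjective : Function.Surjective R.lam.obj := by
  intro e
  obtain ⟨U, hU, -⟩ := R.existsUnique_extension (realizesAtImage_unit S.cone)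
  let V := Realization.desc R.realizesAtImage_lam
  have hV : Realization.unit S.cone ⋙ V = R.lam := Realization.unit_desc _
  have hUV : U ⋙ V = 𝟭 _ := by
    refine R.functor_ext R.realizesAtImage_lam ?_
    rw [← Functor.assoc, hU, hV]
    rfl
  exact ⟨(U.obj e).ob, (Functor.congr_obj hV _).symm.trans (Functor.congr_obj hUV e)⟩

end FibrantReplacement

/-! ### Images of cones under functors -/

section Cones

variable {E : Type u} [Category.{u} E] {D : Type u} [Category.{u} D]

lemma SketchCone.mk_eq {I : Cat.{u, u}} {d d' : I ⥤ E} (h : d = d') {x : E}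
    {π : (Functor.const I).obj x ⟶ d} {π' : (Functor.const I).obj x ⟶ d'}
    (hπ : ∀ i, π.app i ≍ π'.app i) : SketchCone.mk I d ⟨x, π⟩ = SketchCone.mk I d' ⟨x, π'⟩ := by
  subst h
  obtain rfl : π = π' := by
    ext i
    exact eq_of_heq (hπ i)
  rfl

lemma SketchCone.idCone_map (F : E ⥤ D) (e : E) :
    (SketchCone.idCone e).map F = SketchCone.idCone (F.obj e) := by
  have h : (Functor.const (Discrete PUnit.{u + 1})).obj e ⋙ F =
      (Functor.const (Discrete PUnit.{u + 1})).obj (F.obj e) :=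
    Functor.hext (fun _ => rfl) fun _ _ _ => heq_of_eq (F.map_id e)
  exact SketchCone.mk_eq h fun _ => heq_of_eq (F.map_id e)

/-- Unique lifting only concerns cones whose vertex is some `F y`; surjectivity on objects makes
these all cones. -/
lemma SketchCone.isLimit_map {C : SketchCone E} {F : E ⥤ D} (hF : Function.Surjective F.obj)
    (h : ∀ y, LiftsUniquely C y F) : Nonempty (IsLimit (C.map F).cone) := by
  refine ⟨IsLimit.ofExistsUnique fun s => ?_⟩
  obtain ⟨y, hy⟩ := hF s.pt
  obtain ⟨pt, π⟩ := s
  dsimp at hy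
  subst hy
  exact h y (fun i => π.app i) fun i j f => (Cone.w ⟨_, π⟩ f)

lemma LiftsUniquely.comp {C : SketchCone E} {F : E ⥤ D} {B : Type u} [Category.{u} B] {G : D ⥤ B}
    {y : E} (h : LiftsUniquely (C.map F) (F.obj y) G) : LiftsUniquely C y (F ⋙ G) := h

end Cones

/-- `F` carries specified cones to specified cones, on which `G` has unique liftings. Hence `F`
followed by `λ_!` extends along `λ_!`. -/
lemma LimSk.Hom.realizesAtImage_comp {S T : LimSk.{u}} (F : LimSk.Hom S T) {D : Type u}
    [Category.{u} D] {G : T.cat ⥤ D} (hG : RealizesAtImage T.cone G) :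
    RealizesAtImage S.cone (F.functor ⋙ G) := fun y α => by
  have := hG (F.functor.obj y) (F.onIndex α)
  rw [← F.map_cone] at this
  exact this.comp

/-! ### The functor `Fr` and the natural transformation `λ_!` -/

namespace FibrantReplacement

lemma containsIdCones {S : LimSk.{u}} (R : FibrantReplacement S) : R.ContainsIdCones := by
  intro e
  obtain ⟨a, rfl⟩ := R.lam_obj_surjective e
  obtain ⟨α, hα⟩ := S.exists_idCone a
  exact ⟨α, by rw [hα, SketchCone.idCone_map]⟩

lemma isRealized_sketch {S : LimSk.{u}} (R : FibrantReplacement S) :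
    LimSk.IsRealized (R.sketch R.containsIdCones) := fun α =>
  SketchCone.isLimit_map R.lam_obj_surjective fun y => R.realizesAtImage_lam y α

variable (R : ∀ S : LimSk.{u}, FibrantReplacement S) {S T : LimSk.{u}}

/-- The functor between fibrant replacements induced by a map of limit sketches. -/
noncomputable def mapFunctor (F : S ⟶ T) : (R S).fibr ⥤ (R T).fibr :=
  ((R S).existsUnique_extension
    (LimSk.Hom.realizesAtImage_comp F (R T).realizesAtImage_lam)).choose

lemma lam_mapFunctor (F : S ⟶ T) :
    (R S).lam ⋙ mapFunctor R F = F.functor ⋙ (R T).lam :=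
  ((R S).existsUnique_extension
    (LimSk.Hom.realizesAtImage_comp F (R T).realizesAtImage_lam)).choose_spec.1

/-- Uniqueness of extensions, from which identities and composites are strictly preserved. -/
lemma mapFunctor_eq (F : S ⟶ T) {H : (R S).fibr ⥤ (R T).fibr}
    (h : (R S).lam ⋙ H = F.functor ⋙ (R T).lam) : mapFunctor R F = H :=
  ((R S).existsUnique_extension
    (LimSk.Hom.realizesAtImage_comp F (R T).realizesAtImage_lam)).unique (lam_mapFunctor R F) h

/-- The map between the realizations induced by a map of limit sketches. -/
noncomputable def mapSketch (F : S ⟶ T) :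
    (R S).sketch (R S).containsIdCones ⟶ (R T).sketch (R T).containsIdCones where
  functor := mapFunctor R F
  onIndex := F.onIndex
  map_cone α :=
    (congrArg (fun G => (S.cone α).map G) (lam_mapFunctor R F)).trans
      (congrArg (fun C => SketchCone.map C (R T).lam) (F.map_cone α))

/-- The functor `Fr`. -/
noncomputable def realize : LimSk.{u} ⥤ ReLimSk.{u} where
  obj S := ⟨(R S).sketch (R S).containsIdCones, (R S).isRealized_sketch⟩
  map F := ObjectProperty.homMk (mapSketch R F)
  map_id S := by
    ext1
    exact LimSk.Hom.ext (mapFunctor_eq R (𝟙 S) rfl) rfl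
  map_comp {S T U} F G := by
    ext1
    refine LimSk.Hom.ext (mapFunctor_eq R (F ≫ G) ?_) rfl
    change ((R S).lam ⋙ mapFunctor R F) ⋙ mapFunctor R G = _
    rw [lam_mapFunctor, Functor.assoc, lam_mapFunctor]
    rfl

/-- The natural transformation `λ_!`. -/
noncomputable def realizeUnit : 𝟭 LimSk.{u} ⟶ realize R ⋙ LimSk.IsRealized.ι where
  app S := (R S).unit (R S).containsIdCones
  naturality _ _ F := LimSk.Hom.ext (lam_mapFunctor R F).symm rfl

end FibrantReplacement

end LimitSketch

open LimitSketch
theorem mainTheorem3 :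
    (∀ S : LimSk.{u}, Nonempty (FibrantReplacement S)) ∧
    ∀ R : (∀ S : LimSk.{u}, FibrantReplacement S),
      ∃ (hid : ∀ S, (R S).ContainsIdCones)
        (hreal : ∀ S, LimSk.IsRealized ((R S).sketch (hid S)))
        (Fr : LimSk.{u} ⥤ ReLimSk.{u})
        (hFr : ∀ S, Fr.obj S = ⟨(R S).sketch (hid S), hreal S⟩)
        (lam : 𝟭 LimSk.{u} ⟶ Fr ⋙ LimSk.IsRealized.ι),
        ∀ S, lam.app S ≫ eqToHom (congrArg LimSk.IsRealized.ι.obj (hFr S)) =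
          (R S).unit (hid S) := by
  refine ⟨fun S => ⟨standardReplacement S⟩, fun R =>
    ⟨fun S => (R S).containsIdCones, fun S => (R S).isRealized_sketch,
      FibrantReplacement.realize R, fun S => rfl, FibrantReplacement.realizeUnit R, fun S => ?_⟩⟩
  -- The equality on objects holds by `rfl`, so the `eqToHom` is an identity.
  exact Category.comp_id _
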